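/- Let $n\ge 1$ and $m\ge 2$, and let $A=(a_{i_1\cdots i_m})$, $1\le i_1,\dots,i_m\le n$, be a tensor with entries in $\overline{\mathbb R}=\mathbb R\cup\{\infty\}$. For $i=1,\dots,n$ let $$S_i=\bigl\{\{i_2,\dots,i_m\} : a_{i i_2\cdots i_m}\ne\infty\bigr\},$$ where $\{i_2,\dots,i_m\}$ is understood as a multiset. Assume that the sets $S_1,\dots,S_n$ are nonempty and mutually equal. Then $A$ has a tropical H-eigenpair, that is, there is a pair $(x,\lambda)\in \mathbb R^n/\mathbb R(1,\dots,1)\times\mathbb R$ such that $$\min_{1\le i_2,\dots,i_m\le n}\bigl(a_{i i_2\cdots i_m}+x_{i_2}+\cdots+x_{i_m}\bigr)=\lambda+(m-1)x_i,\qquad i=1,\dots,n$$ (a condition that does not depend on the representative of $x$). -/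

import Mathlib

open scoped BigOperators

namespace TropicalTensor

/-- A tensor of order `d + 1` and rank `n` with entries in `ℝ ∪ {∞}`; the entry
`a_{i i₂ ⋯ i_m}`, where `m = d + 1`, is `A (Fin.cons i j)` with `j = (i₂, …, i_m)`. -/
abbrev Tensor (n d : ℕ) : Type := (Fin (d + 1) → Fin n) → WithTop ℝ

/-- `S_i`: the set of multisets `{i₂, …, i_m}` such that `a_{i i₂ ⋯ i_m} ≠ ∞` for
some ordering `(i₂, …, i_m)` of the multiset. -/
def rowSupport {n d : ℕ} (A : Tensor n d) (i : Fin n) : Set (Multiset (Fin n)) :=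
  {s | ∃ j : Fin d → Fin n, A (Fin.cons i j) ≠ ⊤ ∧ s = Finset.univ.val.map j}

/-- A real number as an element of the min-plus semiring `ℝ ∪ {∞}`, in which addition
is the minimum and multiplication is the usual sum. -/
def toTrop (r : ℝ) : Tropical (WithTop ℝ) := Tropical.trop (r : WithTop ℝ)

/-- The eigenvalue equations
`⨁_{i₂, …, i_m} a_{i i₂ ⋯ i_m} ⊙ x_{i₂} ⊙ ⋯ ⊙ x_{i_m} = lam ⊙ x_i^{⊙(m-1)}` for all `i`,
for a vector `x ∈ ℝⁿ`, as equations in the min-plus semiring. -/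
def EigenEquations {n d : ℕ} (A : Tensor n d) (x : Fin n → ℝ) (lam : ℝ) : Prop :=
  ∀ i : Fin n,
    ∑ j : Fin d → Fin n, Tropical.trop (A (Fin.cons i j)) * ∏ k : Fin d, toTrop (x (j k))
      = toTrop lam * toTrop (x i) ^ d

/-- The tropical projective space `ℝⁿ / ℝ(1, …, 1)`. -/
abbrev TropProj (n : ℕ) : Type :=
  (Fin n → ℝ) ⧸ Submodule.span ℝ {(fun _ => 1 : Fin n → ℝ)}

/-- `(X, lam) ∈ ℝⁿ / ℝ(1, …, 1) × ℝ` is a tropical H-eigenpair: the equations hold for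
the representatives of `X` (for one or for all of them, see `isHEigenpair_mk_iff`). -/
def IsHEigenpair {n d : ℕ} (A : Tensor n d) (X : TropProj n) (lam : ℝ) : Prop :=
  ∀ x : Fin n → ℝ, Submodule.Quotient.mk x = X → EigenEquations A x lam

lemma toTrop_add (r s : ℝ) : toTrop (r + s) = toTrop r * toTrop s := by
  simp [toTrop, Tropical.trop_add]

lemma EigenEquations.translate {n d : ℕ} {A : Tensor n d} {x : Fin n → ℝ} {lam : ℝ}
    (h : EigenEquations A x lam) (c : ℝ) : EigenEquations A (fun i => x i + c) lam := by
  intro i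
  have hi := h i
  simp only [toTrop_add, Finset.prod_mul_distrib, Finset.prod_const, Finset.card_univ,
    Fintype.card_fin, mul_pow]
  simp only [← mul_assoc]
  rw [← Finset.sum_mul, hi]

/-- The notion of eigenpair does not depend on the representative. -/
lemma isHEigenpair_mk_iff {n d : ℕ} (A : Tensor n d) (x : Fin n → ℝ) (lam : ℝ) :
    IsHEigenpair A (Submodule.Quotient.mk x) lam ↔ EigenEquations A x lam := by
  refine ⟨fun h => h x rfl, fun h y hy => ?_⟩
  rw [Submodule.Quotient.eq, Submodule.mem_span_singleton] at hy
  obtain ⟨c, hc⟩ := hy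
  have hyx : y = fun i => x i + c := by
    funext i
    have := congrFun hc i
    simp at this
    linarith
  rw [hyx]
  exact h.translate c

end TropicalTensor

/-! With `d = m - 1` and `F i` the real tropical form of row `i`, the map `T = F / d` is sup-norm
nonexpansive and commutes with adding constants; an eigenpair is a solution of `T y = μ + y`, with
`λ = d * μ`. Equal supports mean that all rows use the same monomials and differ only in
coefficients, so `T x` has oscillation bounded independently of `x`. Then the vanishing discount
method applies: fixed points of the contractions `α • T`, normalised at one coordinate, stay in a
compact ball, and a limit as `α → 1` is an eigenvector. -/

open Filter Topology in
/-- A sup-norm nonexpansive self-map of `ℝ^ι` that commutes with the addition of constants and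
whose values have uniformly bounded oscillation has an additive eigenvector. -/
theorem exists_additive_eigenvector {ι : Type*} [Fintype ι] [Nonempty ι]
    (T : (ι → ℝ) → ι → ℝ) (hT : LipschitzWith 1 T)
    (hadd : ∀ (x : ι → ℝ) (c : ℝ) (i : ι), T (fun k => x k + c) i = T x i + c)
    (C : ℝ) (hC : ∀ x i k, T x i ≤ T x k + C) :
    ∃ (y : ι → ℝ) (μ : ℝ), ∀ i, T y i = μ + y i := by
  obtain ⟨i₀⟩ := ‹Nonempty ι›
  have hC0 : 0 ≤ C := by linarith [hC 0 i₀ i₀]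
  have key : ∀ m : ℕ, ∃ y : ι → ℝ, y ∈ Metric.closedBall (0 : ι → ℝ) C ∧
      ∀ i, y i = (1 - 1 / ((m : ℝ) + 1)) * (T y i - T y i₀) := by
    intro m
    have hpos : 0 < 1 / ((m : ℝ) + 1) := by positivity
    have hle : 1 / ((m : ℝ) + 1) ≤ 1 := by
      rw [div_le_one (by positivity)]
      linarith [(Nat.cast_nonneg m : (0 : ℝ) ≤ m)]
    obtain ⟨α, hα⟩ : ∃ α : NNReal, (α : ℝ) = 1 - 1 / ((m : ℝ) + 1) :=
      ⟨⟨1 - 1 / ((m : ℝ) + 1), by linarith⟩, rfl⟩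
    have hα1 : α < 1 := by
      rw [← NNReal.coe_lt_coe, hα, NNReal.coe_one]
      linarith
    have hcontr : ContractingWith α (fun x => (α : ℝ) • T x) := by
      refine ⟨hα1, LipschitzWith.of_dist_le_mul fun x y => ?_⟩
      rw [dist_smul₀, Real.norm_of_nonneg α.coe_nonneg]
      have := hT.dist_le_mul x y
      rw [NNReal.coe_one, one_mul] at this
      gcongr
    obtain ⟨x, hx⟩ : ∃ x, (α : ℝ) • T x = x :=
      ⟨_, hcontr.fixedPoint_isFixedPt⟩
    have hxi : ∀ i, (α : ℝ) * T x i = x i := fun i => congrFun hx i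
    -- The fixed point `x` may blow up as `α → 1`, but its differences are `α` times those of `T x`,
    -- hence at most `C`.
    have hy : ∀ i, x i + -x i₀ = α * (T (fun k => x k + -x i₀) i - T (fun k => x k + -x i₀) i₀) := by
      intro i
      rw [hadd, hadd]
      linarith [hxi i, hxi i₀]
    refine ⟨fun k => x k + -x i₀, ?_, fun i => hα ▸ hy i⟩
    rw [mem_closedBall_zero_iff, pi_norm_le_iff_of_nonneg hC0]
    intro i
    rw [hy i, norm_mul, Real.norm_of_nonneg α.coe_nonneg]
    refine (mul_le_of_le_one_left (norm_nonneg _) (by exact_mod_cast hα1.le)).trans ?_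
    rw [Real.norm_eq_abs, abs_le]
    constructor
    · linarith [hC (fun k => x k + -x i₀) i₀ i]
    · linarith [hC (fun k => x k + -x i₀) i i₀]
  choose y hball hy using key
  obtain ⟨z, -, φ, hφ, hz⟩ := (isCompact_closedBall (0 : ι → ℝ) C).tendsto_subseq hball
  refine ⟨z, T z i₀, fun i => ?_⟩
  have hTz : ∀ k, Tendsto (fun m => T (y (φ m)) k) atTop (𝓝 (T z k)) := fun k =>
    (((continuous_apply k).comp hT.continuous).tendsto z).comp hz
  have hα : Tendsto (fun m => 1 - 1 / ((φ m : ℝ) + 1)) atTop (𝓝 (1 - 0)) :=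
    (tendsto_one_div_add_atTop_nhds_zero_nat.comp hφ.tendsto_atTop).const_sub 1
  have h1 : Tendsto (fun m => y (φ m) i) atTop (𝓝 (z i)) :=
    ((continuous_apply i).tendsto z).comp hz
  have h2 := hα.mul ((hTz i).sub (hTz i₀))
  simp only [← hy] at h2
  linarith [tendsto_nhds_unique h1 h2]

namespace TropicalTensor

open Classical in
/-- The index tuples at which the `i`-th row of `A` is finite. -/
noncomputable def finiteIndices {n d : ℕ} (A : Tensor n d) (i : Fin n) :
    Finset (Fin d → Fin n) :=
  Finset.univ.filter fun j => A (Fin.cons i j) ≠ ⊤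

lemma mem_finiteIndices {n d : ℕ} {A : Tensor n d} {i : Fin n} {j : Fin d → Fin n} :
    j ∈ finiteIndices A i ↔ A (Fin.cons i j) ≠ ⊤ := by
  simp [finiteIndices]

lemma finiteIndices_nonempty {n d : ℕ} {A : Tensor n d} {i : Fin n}
    (h : (rowSupport A i).Nonempty) : (finiteIndices A i).Nonempty := by
  obtain ⟨_, j, hj, _⟩ := h
  exact ⟨j, mem_finiteIndices.2 hj⟩

/-- The value at `x` of the real-valued tropical form given by the `i`-th row of `A`. -/
noncomputable def rowForm {n d : ℕ} (A : Tensor n d) (h : ∀ i, (finiteIndices A i).Nonempty)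
    (x : Fin n → ℝ) (i : Fin n) : ℝ :=
  (finiteIndices A i).inf' (h i) fun j => (A (Fin.cons i j)).untopD 0 + ∑ k, x (j k)

lemma rowForm_le {n d : ℕ} {A : Tensor n d} {h : ∀ i, (finiteIndices A i).Nonempty}
    (x : Fin n → ℝ) {i : Fin n} {j : Fin d → Fin n} (hj : j ∈ finiteIndices A i) :
    rowForm A h x i ≤ (A (Fin.cons i j)).untopD 0 + ∑ k, x (j k) :=
  Finset.inf'_le _ hj

lemma exists_rowForm_eq {n d : ℕ} (A : Tensor n d) (h : ∀ i, (finiteIndices A i).Nonempty)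
    (x : Fin n → ℝ) (i : Fin n) : ∃ j ∈ finiteIndices A i,
      rowForm A h x i = (A (Fin.cons i j)).untopD 0 + ∑ k, x (j k) :=
  Finset.exists_mem_eq_inf' (h i) _

/-- Infinite entries never lower the minimum, so dropping them loses nothing. -/
lemma sum_trop_eq_toTrop_rowForm {n d : ℕ} (A : Tensor n d)
    (h : ∀ i, (finiteIndices A i).Nonempty) (x : Fin n → ℝ) (i : Fin n) :
    ∑ j : Fin d → Fin n, Tropical.trop (A (Fin.cons i j)) * ∏ k : Fin d, toTrop (x (j k))
      = toTrop (rowForm A h x i) := by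
  have hprod : ∀ j : Fin d → Fin n,
      Tropical.untrop (Tropical.trop (A (Fin.cons i j)) * ∏ k : Fin d, toTrop (x (j k)))
        = A (Fin.cons i j) + ((∑ k, x (j k) : ℝ) : WithTop ℝ) := by
    intro j
    rw [Tropical.untrop_mul, _root_.untrop_prod, Tropical.untrop_trop]
    simp [toTrop]
  have hfin : ∀ j ∈ finiteIndices A i, A (Fin.cons i j) + ((∑ k, x (j k) : ℝ) : WithTop ℝ)
      = (((A (Fin.cons i j)).untopD 0 + ∑ k, x (j k) : ℝ) : WithTop ℝ) := by
    intro j hj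
    obtain ⟨a, ha⟩ := WithTop.ne_top_iff_exists.1 (mem_finiteIndices.1 hj)
    rw [← ha, WithTop.untopD_coe, WithTop.coe_add]
  apply Tropical.untrop_injective
  rw [Finset.untrop_sum']
  simp only [Function.comp_def, hprod]
  rw [toTrop, Tropical.untrop_trop]
  apply le_antisymm
  · obtain ⟨j, hj, hje⟩ := exists_rowForm_eq A h x i
    rw [hje, ← hfin j hj]
    exact Finset.inf_le (f := fun j => A (Fin.cons i j) + ((∑ k, x (j k) : ℝ) : WithTop ℝ))
      (Finset.mem_univ j)
  · refine Finset.le_inf fun j _ => ?_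
    by_cases hj : j ∈ finiteIndices A i
    · rw [hfin j hj]
      exact WithTop.coe_le_coe.2 (rowForm_le x hj)
    · rw [mem_finiteIndices, not_not] at hj
      rw [hj, WithTop.top_add]
      exact le_top

lemma rowForm_add_const {n d : ℕ} (A : Tensor n d) (h : ∀ i, (finiteIndices A i).Nonempty)
    (x : Fin n → ℝ) (c : ℝ) (i : Fin n) :
    rowForm A h (fun k => x k + c) i = rowForm A h x i + d * c := by
  have hs : ∀ j : Fin d → Fin n, ∑ k, (x (j k) + c) = ∑ k, x (j k) + d * c := fun j => by
    simp [Finset.sum_add_distrib]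
  apply le_antisymm
  · obtain ⟨j, hj, hje⟩ := exists_rowForm_eq A h x i
    linarith [rowForm_le (h := h) (fun k => x k + c) hj, hs j]
  · obtain ⟨j, hj, hje⟩ := exists_rowForm_eq A h (fun k => x k + c) i
    linarith [rowForm_le (h := h) x hj, hs j]

/-- Test a minimiser for `y` at `x`: each of its `d` variables moves by at most `dist x y`. -/
lemma rowForm_le_add_dist {n d : ℕ} (A : Tensor n d) (h : ∀ i, (finiteIndices A i).Nonempty)
    (x y : Fin n → ℝ) (i : Fin n) : rowForm A h x i ≤ rowForm A h y i + d * dist x y := by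
  obtain ⟨j, hj, hje⟩ := exists_rowForm_eq A h y i
  have hs : ∑ k, x (j k) ≤ ∑ k, (y (j k) + dist x y) := by
    refine Finset.sum_le_sum fun k _ => ?_
    have h1 := dist_le_pi_dist x y (j k)
    rw [Real.dist_eq] at h1
    linarith [le_abs_self (x (j k) - y (j k))]
  have hd : ∑ k, (y (j k) + dist x y) = ∑ k, y (j k) + d * dist x y := by
    simp [Finset.sum_add_distrib]
  linarith [rowForm_le (h := h) x hj]

/-- Rows with equal supports define tropical forms at bounded distance from each other. -/
lemma exists_rowForm_le_add {n d : ℕ} (A : Tensor n d)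
    (h : ∀ i, (finiteIndices A i).Nonempty)
    (heq : ∀ i k : Fin n, rowSupport A i = rowSupport A k) :
    ∃ C : ℝ, ∀ x i k, rowForm A h x i ≤ rowForm A h x k + C := by
  obtain ⟨M, hM⟩ := (Set.finite_range fun v => |(A v).untopD 0|).bddAbove
  have hM' : ∀ v, |(A v).untopD 0| ≤ M := fun v => hM ⟨v, rfl⟩
  refine ⟨2 * M, fun x i k => ?_⟩
  obtain ⟨j, hj, hje⟩ := exists_rowForm_eq A h x k
  -- The monomial minimising row `k` also occurs in row `i`, possibly reordered; only the
  -- coefficients differ, by at most `2 * M`.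
  have hmem : Finset.univ.val.map j ∈ rowSupport A i :=
    heq k i ▸ ⟨j, mem_finiteIndices.1 hj, rfl⟩
  obtain ⟨j', hj', hjj'⟩ := hmem
  have hsum : ∑ l, x (j l) = ∑ l, x (j' l) := by
    have := congrArg (fun s => (Multiset.map x s).sum) hjj'
    rwa [Multiset.map_map, Multiset.map_map] at this
  have h1 := rowForm_le (h := h) x (mem_finiteIndices.2 hj')
  linarith [(abs_le.1 (hM' (Fin.cons i j'))).2, (abs_le.1 (hM' (Fin.cons k j))).1]

end TropicalTensor

theorem mainTheorem6 (n d : ℕ) (hd : 1 ≤ d) (A : TropicalTensor.Tensor n d)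
    (hne : ∀ i : Fin n, (TropicalTensor.rowSupport A i).Nonempty)
    (heq : ∀ i k : Fin n, TropicalTensor.rowSupport A i = TropicalTensor.rowSupport A k) :
    ∃ (X : TropicalTensor.TropProj n) (lam : ℝ), TropicalTensor.IsHEigenpair A X lam := by
  suffices H : ∃ (x : Fin n → ℝ) (lam : ℝ), TropicalTensor.EigenEquations A x lam by
    obtain ⟨x, lam, hx⟩ := H
    exact ⟨Submodule.Quotient.mk x, lam, (TropicalTensor.isHEigenpair_mk_iff A x lam).2 hx⟩
  rcases isEmpty_or_nonempty (Fin n) with hn | hn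
  · exact ⟨0, 0, fun i => hn.elim i⟩
  have h := fun i => TropicalTensor.finiteIndices_nonempty (hne i)
  have hd0 : (0 : ℝ) < d := by exact_mod_cast hd
  obtain ⟨C, hC⟩ := TropicalTensor.exists_rowForm_le_add A h heq
  have H : ∃ (y : Fin n → ℝ) (μ : ℝ), ∀ i, TropicalTensor.rowForm A h y i / d = μ + y i := by
    refine exists_additive_eigenvector
      (fun x i => TropicalTensor.rowForm A h x i / d) ?_ ?_ (C / d) ?_
    · refine LipschitzWith.of_dist_le_mul fun x z => ?_
      rw [NNReal.coe_one, one_mul, dist_pi_le_iff dist_nonneg]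
      intro i
      have h1 := TropicalTensor.rowForm_le_add_dist A h x z i
      have h2 := TropicalTensor.rowForm_le_add_dist A h z x i
      rw [dist_comm z x] at h2
      rw [Real.dist_eq, ← sub_div, abs_div, abs_of_pos hd0, div_le_iff₀ hd0, abs_le]
      constructor <;> linarith
    · intro x c i
      rw [TropicalTensor.rowForm_add_const]
      field_simp
    · intro x i k
      rw [← add_div]
      exact div_le_div_of_nonneg_right (hC x i k) hd0.le
  obtain ⟨y, μ, hy⟩ := H
  refine ⟨y, d * μ, fun i => ?_⟩
  have hyi : TropicalTensor.rowForm A h y i = d * μ + d * y i := by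
    have := hy i
    field_simp at this
    linarith
  have hpow : TropicalTensor.toTrop (d * y i) = TropicalTensor.toTrop (y i) ^ d := by
    apply Tropical.untrop_injective
    rw [Tropical.untrop_pow, ← nsmul_eq_mul]
    exact WithTop.coe_nsmul (y i) d
  rw [TropicalTensor.sum_trop_eq_toTrop_rowForm A h, hyi, TropicalTensor.toTrop_add, hpow]
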